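/- Let $P\subset\mathbb{R}^d$ be a polytope and $\ell$ a linear functional on $\mathbb{R}^d$ (an orientation of $P$). A monotone path on $P$ is a sequence of edges $F_1,\dots,F_k$ of $P$ ($k\ge 1$) such that $\ell$ is non-constant on each $F_i$, the $\ell$-maximal vertex of $F_i$ is the $\ell$-minimal vertex of $F_{i+1}$ for $1\le i<k$, $F_1$ contains a vertex of $P$ at which $\ell$ is minimal on $P$, and $F_k$ contains a vertex of $P$ at which $\ell$ is maximal on $P$. The path is coherent if there is a linear functional $\ell'$ such that $\bigcup_i F_i$ is the set of all $p\in P$ that minimize $\ell'$ on the fiber $\{q\in P:\ell(q)=\ell(p)\}$. The orientation $\ell$ is generic if it takes distinct values at distinct vertices of $P$. Let $\diamond^n=\operatorname{conv}\{\pm e_1,\dots,\pm e_n\}\subset\mathbb{R}^n$ be the standard cross-polytope. Corollary (coherence depends on orientation). (1) That all monotone paths on a polytope are coherent for one orientation does not imply that they are all coherent for every orientation: there are a polytope $P$ and linear functionals $\ell_1,\ell_2$ such that monotone paths for $\ell_1$ exist and all of them are coherent, while some monotone path for $\ell_2$ is not coherent. (2) A polytope may fail to have all monotone paths coherent for every generic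 orientation and still have some orientation for which all monotone paths are coherent. Namely, for every $n\ge 3$: generic orientations of $\diamond^n$ exist; for every generic orientation of $\diamond^n$ there is a monotone path that is not coherent; and for the (non-generic) orientation $\ell(x)=x_1+\dots+x_n$ monotone paths exist and all of them are coherent. -/

import Mathlib

namespace MonotonePaths

section General

variable {E : Type*} [NormedAddCommGroup E] [NormedSpace ℝ E]

/-- A (convex) polytope: the convex hull of a nonempty finite set of points. -/
def IsPolytope (P : Set E) : Prop :=
  ∃ s : Set E, s.Finite ∧ s.Nonempty ∧ P = convexHull ℝ s

/-- The vertices of a polytope, i.e. its zero-dimensional faces. -/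
def vertices (P : Set E) : Set E := P.exposedPoints ℝ

/-- The face of `A` on which the linear functional `ℓ` is maximal. -/
def maxFace (ℓ : StrongDual ℝ E) (A : Set E) : Set E := {x ∈ A | ∀ y ∈ A, ℓ y ≤ ℓ x}

/-- The face of `A` on which the linear functional `ℓ` is minimal. -/
def minFace (ℓ : StrongDual ℝ E) (A : Set E) : Set E := {x ∈ A | ∀ y ∈ A, ℓ x ≤ ℓ y}

/-- A cellular string on the polytope `P` for the orientation given by `ℓ`: a sequence of faces
of `P` whose first member contains an `ℓ`-minimal vertex of `P`, whose last member contains an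
`ℓ`-maximal vertex of `P`, such that `ℓ` is constant on no member, and the `ℓ`-maximal face of
each member is the `ℓ`-minimal face of the next one. (In particular the sequence is nonempty.) -/
structure IsCellularString (P : Set E) (ℓ : StrongDual ℝ E) (F : List (Set E)) : Prop where
  isFace : ∀ A ∈ F, IsExposed ℝ P A
  starts : ∃ A ∈ F.head?, ∃ v ∈ A, v ∈ vertices P ∧ v ∈ minFace ℓ P
  ends : ∃ A ∈ F.getLast?, ∃ v ∈ A, v ∈ vertices P ∧ v ∈ maxFace ℓ P
  nonconstant : ∀ A ∈ F, ∃ x ∈ A, ∃ y ∈ A, ℓ x ≠ ℓ y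
  chain : F.IsChain fun A B => maxFace ℓ A = minFace ℓ B

/-- A monotone path is a cellular string all of whose members are edges, that is, faces of
dimension one. -/
def IsMonotonePath (P : Set E) (ℓ : StrongDual ℝ E) (F : List (Set E)) : Prop :=
  IsCellularString P ℓ F ∧ ∀ A ∈ F, Module.finrank ℝ (vectorSpan ℝ A) = 1

/-- A cellular string is coherent if, for some linear functional `ℓ'`, the union of its members is
the set of those points of `P` that are `ℓ'`-minimal in their fiber of `ℓ : P → ℓ(P)`. -/
def IsCoherent (P : Set E) (ℓ : StrongDual ℝ E) (F : List (Set E)) : Prop :=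
  ∃ ℓ' : StrongDual ℝ E,
    (⋃ A ∈ F, A) = {p | p ∈ P ∧ ∀ q ∈ P, ℓ q = ℓ p → ℓ' p ≤ ℓ' q}

/-- Every monotone path on `P` for the orientation `ℓ` is coherent. -/
def AllPathsCoherent (P : Set E) (ℓ : StrongDual ℝ E) : Prop :=
  ∀ F : List (Set E), IsMonotonePath P ℓ F → IsCoherent P ℓ F

/-- The orientation `ℓ` is generic if it takes distinct values at distinct vertices of `P`. -/
def IsGeneric (P : Set E) (ℓ : StrongDual ℝ E) : Prop := Set.InjOn ℓ (vertices P)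

end General

/-- The standard cross-polytope: the convex hull of `e₁, -e₁, …, eₙ, -eₙ`. -/
def crossPolytope (n : ℕ) : Set (Fin n → ℝ) :=
  convexHull ℝ
    (Set.range (fun i : Fin n => (Pi.single i 1 : Fin n → ℝ)) ∪
      Set.range (fun i : Fin n => -(Pi.single i 1 : Fin n → ℝ)))

end MonotonePaths

namespace MonotonePaths

/-! ### Faces, edges and coherence in a general polytope. -/

section General

variable {E : Type*} [NormedAddCommGroup E] [NormedSpace ℝ E]

/-! Everything happens on the cross-polytope, where two vertices span an edge unless they are
antipodal.

For the coordinate sum, vertices have value 1 or -1, so any face on which `ℓ` varies already runs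
from the bottom to the top of the polytope. A cellular string then has one member, and a functional
exposing that face certifies coherence (`IsCellularString.isCoherent_of_sq_eq_one`).

For a generic orientation, choose signs so that the vertices v_m = ±e_m have distinct positive
heights, with v_k highest and v_j below v_i. The path -v_k, -v_i, -v_j, v_i, v_k contains the
antipodal pair ±v_i. The diagonal from -v_k to v_k meets the fibers of ±v_i in points ±q. If `ℓ'`
certified coherence, minimality at v_i and at -v_i would give opposite inequalities, so `ℓ'` would
agree at q and v_i, and q would lie on the path. It does not
(`exists_isMonotonePath_not_isCoherent`). -/

theorem maxFace_segment {ℓ : StrongDual ℝ E} {u v : E} (h : ℓ u < ℓ v) :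
    maxFace ℓ (segment ℝ u v) = {v} := by
  ext x
  simp only [maxFace, Set.mem_ofPred_eq, Set.mem_singleton_iff]
  constructor
  · rintro ⟨⟨a, b, ha, hb, hab, rfl⟩, hx⟩
    have h1 := hx v (right_mem_segment ℝ u v)
    simp only [map_add, map_smul, smul_eq_mul] at h1
    obtain rfl : b = 1 - a := by linarith
    have : a = 0 := by nlinarith
    simp [this]
  · rintro rfl
    refine ⟨right_mem_segment ℝ u x, ?_⟩
    rintro _ ⟨a, b, ha, hb, hab, rfl⟩
    simp only [map_add, map_smul, smul_eq_mul]
    obtain rfl : b = 1 - a := by linarith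
    nlinarith

theorem minFace_segment {ℓ : StrongDual ℝ E} {u v : E} (h : ℓ u < ℓ v) :
    minFace ℓ (segment ℝ u v) = {u} := by
  have h1 := maxFace_segment (ℓ := -ℓ) (u := v) (v := u) (by simpa using h)
  rw [segment_symm] at h1
  rw [← h1]
  ext x
  simp [minFace, maxFace]

theorem finrank_vectorSpan_segment {u v : E} (h : u ≠ v) :
    Module.finrank ℝ (vectorSpan ℝ (segment ℝ u v)) = 1 := by
  rw [← convexHull_pair, ← direction_affineSpan, affineSpan_convexHull, direction_affineSpan,
    vectorSpan_pair, finrank_span_singleton]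
  simpa [sub_eq_zero] using h

theorem IsPolytope.isCompact {P : Set E} (hP : IsPolytope P) : IsCompact P := by
  obtain ⟨s, hs, -, rfl⟩ := hP
  exact hs.isCompact_convexHull ℝ

theorem IsPolytope.convex {P : Set E} (hP : IsPolytope P) : Convex ℝ P := by
  obtain ⟨s, -, -, rfl⟩ := hP
  exact convex_convexHull ℝ s

/-- A cellular string with a single member is coherent. -/
theorem IsCellularString.isCoherent_singleton {P : Set E} (hP : Convex ℝ P)
    {ℓ : StrongDual ℝ E} {A : Set E} (h : IsCellularString P ℓ [A]) : IsCoherent P ℓ [A] := by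
  obtain ⟨_, hA, u, huA, -, hu⟩ := h.starts
  obtain ⟨_, hA', v, hvA, -, hv⟩ := h.ends
  simp only [List.head?_cons, List.getLast?_singleton, Option.mem_def, Option.some.injEq]
    at hA hA'
  subst hA hA'
  have hexp := h.isFace A (by simp)
  have hconv : Convex ℝ A := hexp.convex hP
  obtain ⟨m, hm⟩ := hexp ⟨u, huA⟩
  -- The image of the convex set `A` is an interval containing both extreme values of `ℓ` on `P`, so
  -- `A` meets every fiber. Minimizing `-m` on a fiber is therefore the same as maximizing `m` on
  -- all of `P`.
  have hfib : ∀ p ∈ P, ∃ q ∈ A, ℓ q = ℓ p := by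
    intro p hp
    have hc : Convex ℝ (ℓ '' A) := hconv.linear_image (ℓ : E →ₗ[ℝ] ℝ)
    have := hc.ordConnected.out (Set.mem_image_of_mem _ huA) (Set.mem_image_of_mem _ hvA)
      ⟨hu.2 p hp, hv.2 p hp⟩
    simpa using this
  refine ⟨-m, ?_⟩
  ext p
  simp only [List.mem_singleton, Set.iUnion_iUnion_eq_left, Set.mem_ofPred_eq,
    neg_apply, neg_le_neg_iff]
  constructor
  · intro hp
    rw [hm] at hp
    exact ⟨hp.1, fun q hq _ => hp.2 q hq⟩
  · rintro ⟨hp, hmin⟩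
    obtain ⟨q, hq, hqp⟩ := hfib p hp
    have hqP : q ∈ P := hexp.subset hq
    have hle := hmin q hqP hqp
    rw [hm] at hq ⊢
    exact ⟨hp, fun y hy => (hq.2 y hy).trans hle⟩

/-- The maximal face of a nonempty face contains an extreme point of the ambient set. -/
theorem exists_extremePoint_mem_maxFace {P A : Set E} (hP : IsCompact P) (hA : IsExposed ℝ P A)
    (hne : A.Nonempty) (ℓ : StrongDual ℝ E) : ∃ v ∈ P.extremePoints ℝ, v ∈ maxFace ℓ A := by
  have hAc : IsCompact A := hA.isCompact hP
  have hexp : IsExposed ℝ A (maxFace ℓ A) := fun _ => ⟨ℓ, rfl⟩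
  obtain ⟨x, hx, hmax⟩ := hAc.exists_isMaxOn hne ℓ.continuous.continuousOn
  obtain ⟨v, hv⟩ := (hexp.isCompact hAc).extremePoints_nonempty ⟨x, hx, fun y hy => hmax hy⟩
  exact ⟨v, (hA.isExtreme.trans hexp.isExtreme).extremePoints_subset_extremePoints hv, hv.1⟩

theorem exists_extremePoint_mem_minFace {P A : Set E} (hP : IsCompact P) (hA : IsExposed ℝ P A)
    (hne : A.Nonempty) (ℓ : StrongDual ℝ E) : ∃ v ∈ P.extremePoints ℝ, v ∈ minFace ℓ A := by
  obtain ⟨v, hv, h⟩ := exists_extremePoint_mem_maxFace hP hA hne (-ℓ)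
  exact ⟨v, hv, h.1, fun y hy => by simpa using h.2 y hy⟩

/-- If `ℓ` takes only the values `-1` and `1` at the extreme points, then every cellular string
has a single member, and so is coherent. -/
theorem IsCellularString.isCoherent_of_sq_eq_one {P : Set E} (hP : IsCompact P)
    (hconv : Convex ℝ P) {ℓ : StrongDual ℝ E} (hℓ : ∀ v ∈ P.extremePoints ℝ, ℓ v = 1 ∨ ℓ v = -1)
    {F : List (Set E)} (h : IsCellularString P ℓ F) : IsCoherent P ℓ F := by
  have hmax : ∀ A ∈ F, ∃ v ∈ maxFace ℓ A, ℓ v = 1 := by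
    intro A hA
    obtain ⟨x, hx, y, hy, hxy⟩ := h.nonconstant A hA
    obtain ⟨v, hv, hvA⟩ := exists_extremePoint_mem_maxFace hP (h.isFace A hA) ⟨x, hx⟩ ℓ
    obtain ⟨w, hw, hwA⟩ := exists_extremePoint_mem_minFace hP (h.isFace A hA) ⟨x, hx⟩ ℓ
    -- A maximum of -1 would force the minimum to be -1 too, making `ℓ` constant on `A`.
    refine ⟨v, hvA, (hℓ v hv).resolve_right fun hv' => hxy ?_⟩
    have := hvA.2 x hx
    have := hvA.2 y hy
    have := hwA.2 x hx
    have := hwA.2 y hy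
    rcases hℓ w hw with hw' | hw' <;> linarith
  have hmin : ∀ A ∈ F, ∃ v ∈ minFace ℓ A, ℓ v = -1 := by
    intro A hA
    obtain ⟨x, hx, y, hy, hxy⟩ := h.nonconstant A hA
    obtain ⟨v, hv, hvA⟩ := exists_extremePoint_mem_maxFace hP (h.isFace A hA) ⟨x, hx⟩ ℓ
    obtain ⟨w, hw, hwA⟩ := exists_extremePoint_mem_minFace hP (h.isFace A hA) ⟨x, hx⟩ ℓ
    refine ⟨w, hwA, (hℓ w hw).resolve_left fun hw' => hxy ?_⟩
    have := hvA.2 x hx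
    have := hvA.2 y hy
    have := hwA.2 x hx
    have := hwA.2 y hy
    rcases hℓ v hv with hv' | hv' <;> linarith
  match F, h, hmax, hmin with
  | [], h, _, _ => obtain ⟨A, hA, -⟩ := h.starts; simp at hA
  | [A], h, _, _ => exact h.isCoherent_singleton hconv
  | A :: B :: L, h, hmax, hmin =>
    exfalso
    obtain ⟨v, hv, hv1⟩ := hmax A (by simp)
    obtain ⟨w, hw, hw1⟩ := hmin B (by simp)
    have hAB : maxFace ℓ A = minFace ℓ B := (List.isChain_cons_cons.1 h.chain).1
    -- The shared face would have value 1 as the top of `A` and -1 as the bottom of `B`.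
    rw [hAB] at hv
    have := hv.2 w hw.1
    linarith

end General

/-! ### Vertices, edges and orientations of the cross-polytope. -/

section CrossPolytope

variable {n : ℕ}

theorem isPolytope_crossPolytope (hn : 0 < n) : IsPolytope (crossPolytope n) :=
  ⟨_, (Set.finite_range _).union (Set.finite_range _), ⟨_, Or.inl ⟨⟨0, hn⟩, rfl⟩⟩, rfl⟩

theorem single_mem_crossPolytope {s : ℝ} (hs : s = 1 ∨ s = -1) (i : Fin n) :
    Pi.single i s ∈ crossPolytope n := by
  apply subset_convexHull
  rcases hs with rfl | rfl
  · exact Or.inl ⟨i, rfl⟩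
  · exact Or.inr ⟨i, (Pi.single_neg i 1).symm⟩

theorem exists_eq_single_of_mem_extremePoints {x : Fin n → ℝ}
    (hx : x ∈ (crossPolytope n).extremePoints ℝ) :
    ∃ (i : Fin n) (s : ℝ), (s = 1 ∨ s = -1) ∧ x = Pi.single i s := by
  rcases extremePoints_convexHull_subset hx with ⟨i, rfl⟩ | ⟨i, rfl⟩
  · exact ⟨i, 1, Or.inl rfl, rfl⟩
  · exact ⟨i, -1, Or.inr rfl, (Pi.single_neg i 1).symm⟩

theorem apply_single (ℓ : StrongDual ℝ (Fin n → ℝ)) (i : Fin n) (s : ℝ) :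
    ℓ (Pi.single i s) = s * ℓ (Pi.single i 1) := by
  rw [← smul_eq_mul, ← map_smul, ← Pi.single_smul, smul_eq_mul, mul_one]

theorem sum_abs_le_one {x : Fin n → ℝ} (hx : x ∈ crossPolytope n) : ∑ i, |x i| ≤ 1 := by
  have hconv : Convex ℝ {x : Fin n → ℝ | ∑ i, |x i| ≤ 1} := by
    intro x hx y hy a b ha hb hab
    simp only [Set.mem_ofPred_eq] at hx hy ⊢
    calc ∑ i, |(a • x + b • y) i| ≤ ∑ i, (a * |x i| + b * |y i|) := by
          refine Finset.sum_le_sum fun i _ => (abs_add_le _ _).trans_eq ?_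
          simp [abs_mul, abs_of_nonneg ha, abs_of_nonneg hb]
      _ = a * ∑ i, |x i| + b * ∑ i, |y i| := by
          rw [Finset.sum_add_distrib, Finset.mul_sum, Finset.mul_sum]
      _ ≤ 1 := by nlinarith
  refine convexHull_min ?_ hconv hx
  rintro _ (⟨i, rfl⟩ | ⟨i, rfl⟩) <;>
    simp [Pi.single_apply, apply_ite abs]

/-- The three-term bound serves the equality case: once two coordinates use up the whole norm, all
others vanish. -/
theorem abs_add_abs_add_abs_le_one {x : Fin n → ℝ} (hx : x ∈ crossPolytope n) {i j : Fin n}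
    (hij : i ≠ j) : |x i| + |x j| ≤ 1 ∧ ∀ k, k ≠ i → k ≠ j → |x i| + |x j| + |x k| ≤ 1 := by
  have h : ∀ t : Finset (Fin n), ∑ m ∈ t, |x m| ≤ 1 := fun t =>
    (Finset.sum_le_sum_of_subset_of_nonneg (Finset.subset_univ t)
      fun _ _ _ => abs_nonneg _).trans (sum_abs_le_one hx)
  refine ⟨by simpa [hij] using h {i, j}, fun k hki hkj => ?_⟩
  simpa [hij, hki.symm, hkj.symm, add_assoc] using h {i, j, k}

/-- Two non-antipodal vertices of the cross-polytope span an edge. -/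
theorem isExposed_segment_single {i j : Fin n} (hij : i ≠ j) {s t : ℝ} (hs : s = 1 ∨ s = -1)
    (ht : t = 1 ∨ t = -1) :
    IsExposed ℝ (crossPolytope n) (segment ℝ (Pi.single i s) (Pi.single j t)) := by
  intro _
  have hss : s * s = 1 := by rcases hs with rfl | rfl <;> norm_num
  have htt : t * t = 1 := by rcases ht with rfl | rfl <;> norm_num
  have hsle : ∀ y : ℝ, s * y ≤ |y| := fun y => by
    rcases hs with rfl | rfl
    · simpa using le_abs_self y
    · simpa using neg_le_abs y
  have htle : ∀ y : ℝ, t * y ≤ |y| := fun y => by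
    rcases ht with rfl | rfl
    · simpa using le_abs_self y
    · simpa using neg_le_abs y
  let l : StrongDual ℝ (Fin n → ℝ) :=
    s • ContinuousLinearMap.proj i + t • ContinuousLinearMap.proj j
  have hl : ∀ x, l x = s * x i + t * x j := fun x => by simp [l]
  refine ⟨l, ?_⟩
  ext x
  simp only [Set.mem_ofPred_eq]
  constructor
  · intro hx
    refine ⟨(convex_convexHull ℝ _).segment_subset (single_mem_crossPolytope hs i)
      (single_mem_crossPolytope ht j) hx, fun y hy => ?_⟩
    have h1 : l x = 1 := by
      obtain ⟨a, b, -, -, hab, rfl⟩ := hx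
      rw [hl]
      simp only [Pi.add_apply, Pi.smul_apply, Pi.single_eq_same, Pi.single_eq_of_ne hij,
        Pi.single_eq_of_ne hij.symm, smul_eq_mul, mul_zero, add_zero, zero_add]
      linear_combination a * hss + b * htt + hab
    rw [h1, hl]
    linarith [(abs_add_abs_add_abs_le_one hy hij).1, hsle (y i), htle (y j)]
  · rintro ⟨hx, hmax⟩
    have h1 := hmax _ (single_mem_crossPolytope hs i)
    rw [hl, hl] at h1
    simp only [Pi.single_eq_same, Pi.single_eq_of_ne hij.symm, mul_zero, add_zero, hss] at h1
    obtain ⟨h2, h3⟩ := abs_add_abs_add_abs_le_one hx hij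
    have h4 := hsle (x i)
    have h5 := htle (x j)
    have ha : s * x i = |x i| := by linarith
    have hb : t * x j = |x j| := by linarith
    refine ⟨s * x i, t * x j, ha ▸ abs_nonneg _, hb ▸ abs_nonneg _, by linarith, ?_⟩
    ext k
    simp only [Pi.add_apply, Pi.smul_apply, smul_eq_mul]
    by_cases hki : k = i
    · subst hki
      rw [Pi.single_eq_same, Pi.single_eq_of_ne hij]
      linear_combination x k * hss
    by_cases hkj : k = j
    · subst hkj
      rw [Pi.single_eq_same, Pi.single_eq_of_ne hki]
      linear_combination x k * htt
    rw [Pi.single_eq_of_ne hki, Pi.single_eq_of_ne hkj]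
    have := h3 k hki hkj
    have : |x k| = 0 := le_antisymm (by linarith) (abs_nonneg _)
    simp [abs_eq_zero.1 this]

theorem single_mem_vertices {s : ℝ} (hs : s = 1 ∨ s = -1) (i : Fin n) :
    Pi.single i s ∈ vertices (crossPolytope n) := by
  have hss : s * s = 1 := by rcases hs with rfl | rfl <;> norm_num
  have hsle : ∀ y : ℝ, s * y ≤ |y| := fun y => by
    rcases hs with rfl | rfl
    · simpa using le_abs_self y
    · simpa using neg_le_abs y
  refine ⟨single_mem_crossPolytope hs i, s • ContinuousLinearMap.proj i, fun y hy => ?_⟩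
  simp only [smul_apply, ContinuousLinearMap.proj_apply, smul_eq_mul,
    Pi.single_eq_same, hss]
  have hle : |y i| ≤ 1 := (Finset.single_le_sum (f := fun m => |y m|)
    (fun _ _ => abs_nonneg _) (Finset.mem_univ i)).trans (sum_abs_le_one hy)
  refine ⟨(hsle _).trans hle, fun h => ?_⟩
  ext k
  by_cases hk : k = i
  · subst hk
    rw [Pi.single_eq_same]
    have : s * y k = 1 := le_antisymm ((hsle _).trans hle) h
    linear_combination s * this - y k * hss
  · rw [Pi.single_eq_of_ne hk]
    have := (abs_add_abs_add_abs_le_one hy hk).1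
    have := hsle (y i)
    exact abs_eq_zero.1 (le_antisymm (by linarith) (abs_nonneg _))

theorem apply_le_of_abs_le {ℓ : StrongDual ℝ (Fin n → ℝ)} {c : ℝ}
    (hc : ∀ i, |ℓ (Pi.single i 1)| ≤ c) {x : Fin n → ℝ} (hx : x ∈ crossPolytope n) :
    ℓ x ≤ c := by
  refine convexHull_min (t := {x | ℓ x ≤ c}) ?_
    (convex_halfSpace_le (ℓ : (Fin n → ℝ) →ₗ[ℝ] ℝ).isLinear c) hx
  rintro _ (⟨i, rfl⟩ | ⟨i, rfl⟩)
  · exact (le_abs_self _).trans (hc i)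
  · simpa using (neg_le_abs _).trans (hc i)

/-- The endpoint conditions for a monotone path hold at a vertex where `|ℓ|` is largest. -/
theorem single_mem_maxFace {ℓ : StrongDual ℝ (Fin n → ℝ)} {k : Fin n} {s : ℝ}
    (hs : s = 1 ∨ s = -1) (hc : ∀ i, |ℓ (Pi.single i 1)| ≤ ℓ (Pi.single k s)) :
    Pi.single k s ∈ maxFace ℓ (crossPolytope n) :=
  ⟨single_mem_crossPolytope hs k, fun _ hy => apply_le_of_abs_le hc hy⟩

theorem single_mem_minFace {ℓ : StrongDual ℝ (Fin n → ℝ)} {k : Fin n} {s : ℝ}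
    (hs : s = 1 ∨ s = -1) (hc : ∀ i, |ℓ (Pi.single i 1)| ≤ -ℓ (Pi.single k s)) :
    Pi.single k s ∈ minFace ℓ (crossPolytope n) := by
  refine ⟨single_mem_crossPolytope hs k, fun y hy => ?_⟩
  have := apply_le_of_abs_le (ℓ := -ℓ) (by simpa using hc) hy
  simp only [neg_apply] at this
  linarith

/-- The linear functional with prescribed coefficients. -/
noncomputable def functional (a : Fin n → ℝ) : StrongDual ℝ (Fin n → ℝ) :=
  ∑ i, a i • ContinuousLinearMap.proj i

theorem functional_single (a : Fin n → ℝ) (i : Fin n) :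
    functional a (Pi.single i 1) = a i := by
  simp [functional, Pi.single_apply]

theorem exists_isGeneric (n : ℕ) :
    ∃ ℓ : StrongDual ℝ (Fin n → ℝ), IsGeneric (crossPolytope n) ℓ := by
  -- The shift by 1 keeps the coefficient of index 0 nonzero, which separates that vertex from its
  -- antipode.
  refine ⟨functional fun i => (i : ℝ) + 1, fun x hx y hy hxy => ?_⟩
  obtain ⟨i, s, hs, rfl⟩ :=
    exists_eq_single_of_mem_extremePoints (exposedPoints_subset_extremePoints hx)
  obtain ⟨j, t, ht, rfl⟩ :=
    exists_eq_single_of_mem_extremePoints (exposedPoints_subset_extremePoints hy)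
  rw [apply_single _ i, apply_single _ j, functional_single, functional_single] at hxy
  have hi : (0 : ℝ) ≤ (i : ℕ) := Nat.cast_nonneg _
  have hj : (0 : ℝ) ≤ (j : ℕ) := Nat.cast_nonneg _
  rcases hs with rfl | rfl <;> rcases ht with rfl | rfl
  · have : ((i : ℕ) : ℝ) = (j : ℕ) := by linarith
    rw [Fin.ext (Nat.cast_injective this)]
  · linarith
  · linarith
  · have : ((i : ℕ) : ℝ) = (j : ℕ) := by linarith
    rw [Fin.ext (Nat.cast_injective this)]

theorem exists_isMonotonePath_not_isCoherent (hn : 3 ≤ n) {ℓ : StrongDual ℝ (Fin n → ℝ)}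
    (hℓ : IsGeneric (crossPolytope n) ℓ) :
    ∃ F, IsMonotonePath (crossPolytope n) ℓ F ∧ ¬ IsCoherent (crossPolytope n) ℓ F := by
  have hsign : ∀ i : Fin n, ∃ s : ℝ, (s = 1 ∨ s = -1) ∧
      ℓ (Pi.single i s) = |ℓ (Pi.single i 1)| := by
    intro i
    rcases abs_choice (ℓ (Pi.single i 1)) with h | h
    · exact ⟨1, Or.inl rfl, h.symm⟩
    · exact ⟨-1, Or.inr rfl, by rw [h, apply_single, neg_one_mul]⟩
  choose s hs hst using hsign
  have hs' : ∀ i, -s i = 1 ∨ -s i = -1 := fun i => by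
    rcases hs i with h | h <;> simp [h]
  have hs0 : ∀ i, s i ≠ 0 := fun i => by rcases hs i with h | h <;> simp [h]
  set t : Fin n → ℝ := fun i => |ℓ (Pi.single i 1)| with ht
  have hst' : ∀ i, ℓ (Pi.single i (-s i)) = -t i := fun i => by
    rw [Pi.single_neg, map_neg, hst]
  have htpos : ∀ i, 0 < t i := by
    intro i
    -- At height 0, two antipodal vertices would share a value, against genericity.
    refine lt_of_le_of_ne (abs_nonneg _) fun h0 => ?_
    have := hℓ (single_mem_vertices (hs i) i) (single_mem_vertices (hs' i) i)
      (by rw [hst, hst']; change t i = _; rw [← h0, neg_zero])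
    have h2 := congrFun this i
    simp only [Pi.single_eq_same] at h2
    exact hs0 i (by linarith)
  have htinj : Function.Injective t := by
    intro i j hij
    have := hℓ (single_mem_vertices (hs i) i) (single_mem_vertices (hs j) j)
      (by rw [hst, hst]; exact hij)
    by_contra hne
    have h2 := congrFun this i
    rw [Pi.single_eq_same, Pi.single_eq_of_ne hne] at h2
    exact hs0 i h2
  obtain ⟨k, hk⟩ : ∃ k, ∀ i, t i ≤ t k := by
    have : Nonempty (Fin n) := ⟨⟨0, by omega⟩⟩
    exact Finite.exists_max t
  obtain ⟨i, j, hik, hjk, hij, htij⟩ : ∃ i j, i ≠ k ∧ j ≠ k ∧ i ≠ j ∧ t j < t i := by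
    have hcard : 1 < (Finset.univ.erase k).card := by
      rw [Finset.card_erase_of_mem (Finset.mem_univ k), Finset.card_univ, Fintype.card_fin]
      omega
    obtain ⟨a, ha, b, hb, hab⟩ := Finset.one_lt_card.1 hcard
    have ha := Finset.ne_of_mem_erase ha
    have hb := Finset.ne_of_mem_erase hb
    rcases lt_or_gt_of_ne (htinj.ne hab) with h | h
    · exact ⟨b, a, hb, ha, hab.symm, h⟩
    · exact ⟨a, b, ha, hb, hab, h⟩
  have htik : t i < t k := lt_of_le_of_ne (hk i) (htinj.ne hik)
  have hi := htpos i
  have hj := htpos j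
  have l1 : ℓ (Pi.single k (-s k)) < ℓ (Pi.single i (-s i)) := by rw [hst', hst']; linarith
  have l2 : ℓ (Pi.single i (-s i)) < ℓ (Pi.single j (-s j)) := by rw [hst', hst']; linarith
  have l3 : ℓ (Pi.single j (-s j)) < ℓ (Pi.single i (s i)) := by
    rw [hst', hst]; change _ < t i; linarith
  have l4 : ℓ (Pi.single i (s i)) < ℓ (Pi.single k (s k)) := by rw [hst, hst]; exact htik
  have hedge : ∀ {u v : Fin n → ℝ}, ℓ u < ℓ v →
      (∃ x ∈ segment ℝ u v, ∃ y ∈ segment ℝ u v, ℓ x ≠ ℓ y) ∧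
      Module.finrank ℝ (vectorSpan ℝ (segment ℝ u v)) = 1 := fun {u v} h =>
    ⟨⟨u, left_mem_segment ℝ u v, v, right_mem_segment ℝ u v, h.ne⟩,
      finrank_vectorSpan_segment fun huv => h.ne (congrArg ℓ huv)⟩
  -- The detour through `-s j` is needed because the antipodal vertices in direction `i` are not
  -- joined by an edge.
  refine ⟨[segment ℝ (Pi.single k (-s k)) (Pi.single i (-s i)),
    segment ℝ (Pi.single i (-s i)) (Pi.single j (-s j)),
    segment ℝ (Pi.single j (-s j)) (Pi.single i (s i)),
    segment ℝ (Pi.single i (s i)) (Pi.single k (s k))], ⟨⟨?_, ?_, ?_, ?_, ?_⟩, ?_⟩, ?_⟩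
  · simp only [List.forall_mem_cons, List.not_mem_nil, false_imp_iff, implies_true, and_true]
    exact ⟨isExposed_segment_single hik.symm (hs' k) (hs' i),
      isExposed_segment_single hij (hs' i) (hs' j),
      isExposed_segment_single hij.symm (hs' j) (hs i),
      isExposed_segment_single hik (hs i) (hs k)⟩
  · refine ⟨_, rfl, _, left_mem_segment ℝ _ _, single_mem_vertices (hs' k) k,
      single_mem_minFace (hs' k) fun m => ?_⟩
    rw [hst', neg_neg]
    exact hk m
  · refine ⟨_, rfl, _, right_mem_segment ℝ _ _, single_mem_vertices (hs k) k,
      single_mem_maxFace (hs k) fun m => ?_⟩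
    rw [hst]
    exact hk m
  · simp only [List.forall_mem_cons, List.not_mem_nil, false_imp_iff, implies_true, and_true]
    exact ⟨(hedge l1).1, (hedge l2).1, (hedge l3).1, (hedge l4).1⟩
  · simp only [List.isChain_cons_cons, List.isChain_singleton, and_true]
    exact ⟨(maxFace_segment l1).trans (minFace_segment l2).symm,
      (maxFace_segment l2).trans (minFace_segment l3).symm,
      (maxFace_segment l3).trans (minFace_segment l4).symm⟩
  · simp only [List.forall_mem_cons, List.not_mem_nil, false_imp_iff, implies_true, and_true]
    exact ⟨(hedge l1).2, (hedge l2).2, (hedge l3).2, (hedge l4).2⟩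
  rintro ⟨ℓ', h⟩
  -- The point on the ray through the last vertex in the fiber of the vertex `i`.
  set r : ℝ := t i / t k with hr
  have hr0 : 0 < r := div_pos hi (htpos k)
  have hr1 : r < 1 := (div_lt_one (htpos k)).2 htik
  set q : Fin n → ℝ := r • Pi.single k (s k) with hq
  have hrt : r * t k = t i := div_mul_cancel₀ _ (htpos k).ne'
  have hball : ∀ c : ℝ, |c| ≤ 1 → c • Pi.single k (s k) ∈ crossPolytope n := by
    intro c hc
    obtain ⟨hc1, hc2⟩ := abs_le.1 hc
    refine (convex_convexHull ℝ _).segment_subset (single_mem_crossPolytope (hs k) k)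
      (single_mem_crossPolytope (hs' k) k)
      ⟨(1 + c) / 2, (1 - c) / 2, by linarith, by linarith, by ring, ?_⟩
    rw [Pi.single_neg, smul_neg, ← sub_eq_add_neg, ← sub_smul]
    congr 1
    ring
  have hqP : q ∈ crossPolytope n := hball r (by rw [abs_of_pos hr0]; exact hr1.le)
  have hqP' : -q ∈ crossPolytope n := by
    rw [hq, ← neg_smul]
    exact hball (-r) (by rw [abs_neg, abs_of_pos hr0]; exact hr1.le)
  have hℓq : ℓ q = ℓ (Pi.single i (s i)) := by
    rw [hq, map_smul, hst, hst, smul_eq_mul]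
    exact hrt
  have hi1 : Pi.single i (s i) ∈ {p | p ∈ crossPolytope n ∧
      ∀ q ∈ crossPolytope n, ℓ q = ℓ p → ℓ' p ≤ ℓ' q} := by
    rw [← h]
    simp only [List.mem_cons, List.not_mem_nil, or_false, Set.iUnion_iUnion_eq_or_left,
      Set.iUnion_iUnion_eq_left, Set.mem_union]
    exact Or.inr (Or.inr (Or.inr (left_mem_segment ℝ _ _)))
  have hi2 : Pi.single i (-s i) ∈ {p | p ∈ crossPolytope n ∧
      ∀ q ∈ crossPolytope n, ℓ q = ℓ p → ℓ' p ≤ ℓ' q} := by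
    rw [← h]
    simp only [List.mem_cons, List.not_mem_nil, or_false, Set.iUnion_iUnion_eq_or_left,
      Set.iUnion_iUnion_eq_left, Set.mem_union]
    exact Or.inl (right_mem_segment ℝ _ _)
  -- Minimality at the lower antipode, negated, bounds `ℓ' q` above by the minimum over the upper
  -- fiber, so `q` is a minimizer there.
  have h2 := hi2.2 (-q) hqP' (by rw [map_neg, hℓq, hst, hst'])
  rw [Pi.single_neg, map_neg, map_neg, neg_le_neg_iff] at h2
  have hqS : q ∈ {p | p ∈ crossPolytope n ∧
      ∀ q ∈ crossPolytope n, ℓ q = ℓ p → ℓ' p ≤ ℓ' q} :=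
    ⟨hqP, fun y hy hyq => h2.trans (hi1.2 y hy (hyq.trans hℓq))⟩
  rw [← h] at hqS
  simp only [List.mem_cons, List.not_mem_nil, or_false, Set.iUnion_iUnion_eq_or_left,
    Set.iUnion_iUnion_eq_left, Set.mem_union] at hqS
  have hqk : q k = r * s k := by simp [hq]
  have hqi : q i = 0 := by simp [hq, hik]
  have hrs : r * s k ≠ 0 := mul_ne_zero hr0.ne' (hs0 k)
  -- Coordinate `k` of `q` is `r * s k`: it has the wrong sign for the first edge and is nonzero,
  -- unlike on the two middle edges. On the last edge, `q i = 0` leaves only the endpoint, which `r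
  -- < 1` excludes.
  rcases hqS with ⟨a, b, ha, hb, hab, he⟩ | ⟨a, b, ha, hb, hab, he⟩ |
    ⟨a, b, ha, hb, hab, he⟩ | ⟨a, b, ha, hb, hab, he⟩
  · have := congrFun he k
    simp [hqk, hik.symm] at this
    have : (r + a) * s k = 0 := by linarith
    rcases mul_eq_zero.1 this with h0 | h0
    · linarith
    · exact hs0 k h0
  · have := congrFun he k
    simp only [hqk, Pi.add_apply, Pi.smul_apply, Pi.single_eq_of_ne hik.symm,
      Pi.single_eq_of_ne hjk.symm, smul_zero, add_zero] at this
    exact hrs this.symm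
  · have := congrFun he k
    simp only [hqk, Pi.add_apply, Pi.smul_apply, Pi.single_eq_of_ne hik.symm,
      Pi.single_eq_of_ne hjk.symm, smul_zero, add_zero] at this
    exact hrs this.symm
  · have h3 := congrFun he i
    have h4 := congrFun he k
    simp only [hqi, Pi.add_apply, Pi.smul_apply, Pi.single_eq_of_ne hik, Pi.single_eq_same,
      mul_zero, add_zero, smul_eq_mul] at h3
    simp only [hqk, Pi.add_apply, Pi.smul_apply, Pi.single_eq_of_ne hik.symm,
      Pi.single_eq_same, mul_zero, zero_add, smul_eq_mul] at h4
    have ha0 : a = 0 := (mul_eq_zero.1 h3).resolve_right (hs0 i)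
    have := mul_right_cancel₀ (hs0 k) h4
    linarith

/-- For the orientation by the sum of the coordinates there are monotone paths, and all of them
are coherent. -/
theorem exists_allPathsCoherent (hn : 2 ≤ n) : ∃ ℓ : StrongDual ℝ (Fin n → ℝ),
    (∀ i : Fin n, ℓ (Pi.single i 1) = 1) ∧ (∃ F, IsMonotonePath (crossPolytope n) ℓ F) ∧
      AllPathsCoherent (crossPolytope n) ℓ := by
  obtain ⟨ℓ, hℓ⟩ : ∃ ℓ : StrongDual ℝ (Fin n → ℝ), ∀ i : Fin n, ℓ (Pi.single i 1) = 1 :=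
    ⟨functional fun _ => 1, functional_single _⟩
  have hP := isPolytope_crossPolytope (n := n) (by omega)
  have hs : ∀ (i : Fin n) (s : ℝ), ℓ (Pi.single i s) = s := fun i s => by
    rw [apply_single, hℓ, mul_one]
  refine ⟨ℓ, hℓ, ?_, fun F hF => hF.1.isCoherent_of_sq_eq_one hP.isCompact hP.convex ?_⟩
  · let i : Fin n := ⟨0, by omega⟩
    let j : Fin n := ⟨1, by omega⟩
    have hij : i ≠ j := by simp [i, j]
    have hlt : ℓ (Pi.single i (-1)) < ℓ (Pi.single j 1) := by rw [hs, hs]; norm_num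
    refine ⟨[segment ℝ (Pi.single i (-1)) (Pi.single j 1)], ⟨?_, ?_, ?_, ?_, ?_⟩, ?_⟩
    · simpa using isExposed_segment_single hij (Or.inr rfl) (Or.inl rfl)
    · refine ⟨_, rfl, _, left_mem_segment ℝ _ _, single_mem_vertices (Or.inr rfl) i,
        single_mem_minFace (Or.inr rfl) fun m => ?_⟩
      rw [hs, hs]; norm_num
    · refine ⟨_, rfl, _, right_mem_segment ℝ _ _, single_mem_vertices (Or.inl rfl) j,
        single_mem_maxFace (Or.inl rfl) fun m => ?_⟩
      rw [hs, hs]; norm_num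
    · simp only [List.mem_singleton, forall_eq]
      exact ⟨_, left_mem_segment ℝ _ _, _, right_mem_segment ℝ _ _, hlt.ne⟩
    · exact List.isChain_singleton _
    · simp only [List.mem_singleton, forall_eq]
      exact finrank_vectorSpan_segment fun h => hlt.ne (congrArg ℓ h)
  · intro v hv
    obtain ⟨i, s, h, rfl⟩ := exists_eq_single_of_mem_extremePoints hv
    rwa [hs]

end CrossPolytope

end MonotonePaths

theorem mainTheorem7 :
    (∃ (d : ℕ) (P : Set (Fin d → ℝ)), MonotonePaths.IsPolytope P ∧
      ∃ ℓ₁ ℓ₂ : StrongDual ℝ (Fin d → ℝ),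
        (∃ F, MonotonePaths.IsMonotonePath P ℓ₁ F) ∧
        MonotonePaths.AllPathsCoherent P ℓ₁ ∧
        ¬ MonotonePaths.AllPathsCoherent P ℓ₂) ∧
    (∀ n : ℕ, 3 ≤ n →
      (∃ ℓ : StrongDual ℝ (Fin n → ℝ),
        MonotonePaths.IsGeneric (MonotonePaths.crossPolytope n) ℓ) ∧
      (∀ ℓ : StrongDual ℝ (Fin n → ℝ),
        MonotonePaths.IsGeneric (MonotonePaths.crossPolytope n) ℓ →
        ∃ F, MonotonePaths.IsMonotonePath (MonotonePaths.crossPolytope n) ℓ F ∧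
          ¬ MonotonePaths.IsCoherent (MonotonePaths.crossPolytope n) ℓ F) ∧
      (∃ ℓ : StrongDual ℝ (Fin n → ℝ),
        (∀ i : Fin n, ℓ (Pi.single i 1) = 1) ∧
        (∃ F, MonotonePaths.IsMonotonePath (MonotonePaths.crossPolytope n) ℓ F) ∧
        MonotonePaths.AllPathsCoherent (MonotonePaths.crossPolytope n) ℓ)) := by
  refine ⟨?_, fun n hn => ⟨MonotonePaths.exists_isGeneric n,
    fun ℓ hℓ => MonotonePaths.exists_isMonotonePath_not_isCoherent hn hℓ,
    MonotonePaths.exists_allPathsCoherent (by omega)⟩⟩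
  obtain ⟨ℓ₁, -, hex, hall⟩ := MonotonePaths.exists_allPathsCoherent (n := 3) (by norm_num)
  obtain ⟨ℓ₂, hℓ₂⟩ := MonotonePaths.exists_isGeneric 3
  obtain ⟨F, hF, hF'⟩ := MonotonePaths.exists_isMonotonePath_not_isCoherent le_rfl hℓ₂
  exact ⟨3, _, MonotonePaths.isPolytope_crossPolytope (by norm_num), ℓ₁, ℓ₂, hex, hall,
    fun h => hF' (h F hF)⟩
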